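/- Let $n\in\mathbb N$, $\alpha\in(0,1)$ and $T>0$. For $k\in\mathbb{N}$ and a function $\varphi:[0,T]\to\mathbb R^k$ put $$(I^\alpha\varphi)(t)=\frac1{\Gamma(\alpha)}\int_0^t\frac{\varphi(\tau)}{(t-\tau)^{1-\alpha}}\,d\tau,\qquad (D^\alpha \varphi)(t)=\frac1{\Gamma(1-\alpha)}\frac{d}{dt}\int_0^t\frac{\varphi(\tau)}{(t-\tau)^{\alpha}}\,d\tau,\qquad t\in[0,T]$$ (the left-sided Riemann–Liouville fractional integral and derivative of order $\alpha$), and let $I^\alpha(L^\infty([0,T],\mathbb R^k))$ be the set of functions $x:[0,T]\to\mathbb R^k$ for which there is an essentially bounded measurable $\varphi:[0,T]\to\mathbb R^k$ with $x(t)=(I^\alpha\varphi)(t)$ for all $t\in[0,T]$. Let $V:\mathbb R^n\to\mathbb R$ be convex and differentiable with $V(0)=0$, and suppose that for every $r\ge 0$ there is $\lambda_V>0$ such that $\|\nabla V(u)-\nabla V(v)\|\le\lambda_V\|u-v\|$ for all $u,v\in\mathbb R^n$ with $\|u\|\le r$, $\|v\|\le r$. Let $x\in I^\alpha(L^\infty([0,T],\mathbb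 R^n))$ and $y(t)=V(x(t))$, $t\in[0,T]$. Then $y\in I^\alpha(L^\infty([0,T],\mathbb R))$, and for almost every $t\in[0,T]$ the values $(D^\alpha x)(t)$ and $(D^\alpha y)(t)$ are well defined and $$(D^\alpha y)(t)\le\langle\nabla V(x(t)),(D^\alpha x)(t)\rangle .$$ -/

import Mathlib

open MeasureTheory Set

noncomputable section

/-- The left-sided Riemann-Liouville fractional integral of order `α`:
`(I^α φ)(t) = (1 / Γ(α)) ∫₀ᵗ φ(τ) / (t - τ)^(1 - α) dτ`. -/
def rlIntegral {E : Type*} [NormedAddCommGroup E] [NormedSpace ℝ E]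
    (α : ℝ) (φ : ℝ → E) (t : ℝ) : E :=
  (1 / Real.Gamma α) • ∫ τ in (0 : ℝ)..t, (1 / (t - τ) ^ (1 - α)) • φ τ

/-- `x ∈ I^α(L^∞([0, T], E))`: on `[0, T]` the function `x` is the fractional integral of order `α`
of an essentially bounded measurable function. Values of `x` outside `[0, T]` are irrelevant. -/
def MemRLIntegralLinfty {E : Type*} [NormedAddCommGroup E] [NormedSpace ℝ E]
    (T α : ℝ) (x : ℝ → E) : Prop :=
  ∃ φ : ℝ → E, MemLp φ ⊤ (volume.restrict (Icc 0 T)) ∧ ∀ t ∈ Icc 0 T, x t = rlIntegral α φ t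

/-- The function `s ↦ ∫₀ˢ x(τ) / (s - τ)^α dτ`, whose derivative gives the Riemann-Liouville
derivative of order `α`. -/
def rlKernelIntegral {E : Type*} [NormedAddCommGroup E] [NormedSpace ℝ E]
    (α : ℝ) (x : ℝ → E) (s : ℝ) : E :=
  ∫ τ in (0 : ℝ)..s, (1 / (s - τ) ^ α) • x τ

/-- The Riemann-Liouville derivative of order `α` on `[0, T]`:
`(D^α x)(t) = (1 / Γ(1 - α)) (d/dt) ∫₀ᵗ x(τ) / (t - τ)^α dτ`, with the derivative taken within
`[0, T]` (one-sided at the end points). -/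
def rlDeriv {E : Type*} [NormedAddCommGroup E] [NormedSpace ℝ E]
    (T α : ℝ) (x : ℝ → E) (t : ℝ) : E :=
  (1 / Real.Gamma (1 - α)) • derivWithin (rlKernelIntegral α x) (Icc 0 T) t

/-- The value `(D^α x)(t)` is well defined: the integrals `∫₀ˢ x(τ) / (s - τ)^α dτ`, `s ∈ [0, T]`,
exist in the sense of Lebesgue, and the function of `s` that they define is differentiable
at `t`. -/
def RLDifferentiableAt {E : Type*} [NormedAddCommGroup E] [NormedSpace ℝ E]
    (T α : ℝ) (x : ℝ → E) (t : ℝ) : Prop :=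
  (∀ s ∈ Icc 0 T, IntervalIntegrable (fun τ => (1 / (s - τ) ^ α) • x τ) volume 0 s) ∧
    DifferentiableWithinAt ℝ (rlKernelIntegral α x) (Icc 0 T) t

end

open Filter Topology

/-! Write `x = I^α φ` with `φ` bounded and extended by zero to negative times. Such an `x` is
`α`-Hölder. For a `C¹` path `z` with `z 0 = 0`, `D^α (V ∘ z)` is the `(1 - α)`-fractional integral
of `⟨∇V(z), z'⟩`. Integrating `(t - τ)^(-α)` times the Bregman distance `B(z t, z τ)` by parts gives
(`abelIntegral_inner_gradient`) `Γ(1 - α) D^α (V ∘ z)(t) = ⟨∇V(z t), Γ(1 - α) D^α z(t)⟩ - t^(-α) B(z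
t, 0) - α ∫₀ᵗ (t - τ)^(-α - 1) B(z t, z τ) dτ`. Convexity makes `B` nonnegative, which is the
inequality. The local Lipschitz bound on `∇V` makes `B` quadratic in the increment, hence `O((t -
τ)^(2α))` along a Hölder path, so the singular integral converges.

Since `x` need not be `C¹`, it is replaced by its backward averages `z_k`. These keep the Hölder
constant, vanish at `0`, and satisfy `D^α z_k =` average of `φ`
(`abelIntegral_deriv_movingAverage`). All bounds are uniform in `k`. By Lebesgue differentiation and
dominated convergence the identity passes to the limit and exhibits `V ∘ x` as `I^α ψ` with `ψ`
bounded and `ψ ≤ ⟨∇V(x), φ⟩` (`exists_rlIntegral_comp_eq`). Finally `D^α I^α` is the identity almost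
everywhere (`ae_rlDeriv_eq`), which turns this into the claim. -/

/-- The unnormalized Abel integral `∫₀ᵗ (t - s)^(β - 1) f(s) ds`. -/
noncomputable def abelIntegral {E : Type*} [NormedAddCommGroup E] [NormedSpace ℝ E]
    (β : ℝ) (f : ℝ → E) (t : ℝ) : E :=
  ∫ s in (0 : ℝ)..t, (t - s) ^ (β - 1) • f s

/-! ### Power kernels and the Beta integral. -/

section Kernel

theorem intervalIntegrable_sub_rpow {r : ℝ} (hr : -1 < r) (t a b : ℝ) :
    IntervalIntegrable (fun s => (t - s) ^ r) volume a b := by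
  have h := (intervalIntegral.intervalIntegrable_rpow' (a := t - a) (b := t - b) hr).comp_sub_left t
  simpa using h

theorem integral_sub_rpow {β : ℝ} (hβ : 0 < β) (t a b : ℝ) :
    ∫ s in a..b, (t - s) ^ (β - 1) = ((t - a) ^ β - (t - b) ^ β) / β := by
  rw [intervalIntegral.integral_comp_sub_left (fun u => u ^ (β - 1)) t,
    integral_rpow (Or.inl (by linarith))]
  simp

/-- The Beta integral, translated and rescaled. Because `α + β = 1`, the power of `t - a` disappears
and the factor `Γ(α + β)` is `1`. -/
theorem integral_beta_shift {α β : ℝ} (hα : 0 < α) (hβ : 0 < β) (hαβ : α + β = 1)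
    {a t : ℝ} (hat : a < t) :
    ∫ s in a..t, (t - s) ^ (α - 1) * (s - a) ^ (β - 1) = Real.Gamma α * Real.Gamma β := by
  have h1 := Complex.betaIntegral_scaled (β : ℂ) (α : ℂ) (sub_pos.2 hat)
  have h2 := Complex.Gamma_mul_Gamma_eq_betaIntegral (s := (β : ℂ)) (t := (α : ℂ))
    (by simpa using hβ) (by simpa using hα)
  have h3 : (β : ℂ) + α = 1 := by rw [add_comm]; exact_mod_cast hαβ
  rw [h3, Complex.Gamma_one, one_mul] at h2
  rw [h3, sub_self, Complex.cpow_zero, one_mul, ← h2, Complex.Gamma_ofReal, Complex.Gamma_ofReal]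
    at h1
  have h4 : ∫ x in (0 : ℝ)..(t - a), (x : ℂ) ^ ((β : ℂ) - 1) * (((t - a : ℝ) : ℂ) - x) ^ ((α : ℂ) - 1)
      = ((∫ x in (0 : ℝ)..(t - a), (t - a - x) ^ (α - 1) * x ^ (β - 1) : ℝ) : ℂ) := by
    rw [← intervalIntegral.integral_ofReal]
    refine intervalIntegral.integral_congr fun x hx => ?_
    rw [uIcc_of_le (by linarith)] at hx
    have e1 : ((x ^ (β - 1) : ℝ) : ℂ) = (x : ℂ) ^ ((β : ℂ) - 1) := by
      rw [Complex.ofReal_cpow hx.1]; push_cast; rfl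
    have e2 : (((t - a - x) ^ (α - 1) : ℝ) : ℂ) = ((t - a : ℝ) - x : ℂ) ^ ((α : ℂ) - 1) := by
      rw [Complex.ofReal_cpow (by linarith [hx.2])]; push_cast; rfl
    simp only [Complex.ofReal_mul]
    rw [e1, e2, mul_comm]
  rw [h4] at h1
  have h5 : ∫ x in (0 : ℝ)..(t - a), (t - a - x) ^ (α - 1) * x ^ (β - 1)
      = Real.Gamma β * Real.Gamma α := by exact_mod_cast h1
  have h6 := intervalIntegral.integral_comp_sub_right
    (fun x => (t - a - x) ^ (α - 1) * x ^ (β - 1)) (a := a) (b := t) a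
  rw [sub_self, h5] at h6
  rw [mul_comm (Real.Gamma α), ← h6]
  refine intervalIntegral.integral_congr fun s _ => ?_
  simp

/-- A nonintegrable function has integral `0` by convention, whereas this integral is known to be
positive. -/
theorem integrableOn_beta_shift {α β : ℝ} (hα : 0 < α) (hβ : 0 < β) (hαβ : α + β = 1)
    {a t : ℝ} (hat : a < t) :
    IntegrableOn (fun s => (t - s) ^ (α - 1) * (s - a) ^ (β - 1)) (Ioc a t) := by
  by_contra h
  have h1 := integral_beta_shift hα hβ hαβ hat
  rw [intervalIntegral.integral_of_le hat.le, integral_undef h] at h1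
  have := mul_pos (Real.Gamma_pos_of_pos hα) (Real.Gamma_pos_of_pos hβ)
  linarith

end Kernel

/-! ### Composition of Abel integrals of complementary orders. -/

section Semigroup

variable {E : Type*} [NormedAddCommGroup E] [NormedSpace ℝ E]

/-- Tonelli: for fixed `τ` the kernel integrates in `s` to the constant `Γ(α) Γ(β)`, so
integrability of `f` is enough. The indicator encodes the triangle `τ < s ≤ t`. -/
theorem integrable_abel_kernel_prod {α β : ℝ} (hα : 0 < α) (hβ : 0 < β) (hαβ : α + β = 1)
    {f : ℝ → E} {t : ℝ} (ht : 0 ≤ t) (hf : IntervalIntegrable f volume 0 t) :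
    Integrable (Function.uncurry fun s τ : ℝ =>
      (Ioc τ t).indicator (fun s => (t - s) ^ (α - 1) * (s - τ) ^ (β - 1)) s • f τ)
      ((volume.restrict (Ioc 0 t)).prod (volume.restrict (Ioc 0 t))) := by
  have hf' : IntegrableOn f (Ioc 0 t) := (intervalIntegrable_iff_integrableOn_Ioc_of_le ht).1 hf
  have hmeas : AEStronglyMeasurable (Function.uncurry fun s τ : ℝ =>
      (Ioc τ t).indicator (fun s => (t - s) ^ (α - 1) * (s - τ) ^ (β - 1)) s • f τ)
      ((volume.restrict (Ioc 0 t)).prod (volume.restrict (Ioc 0 t))) := by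
    refine AEStronglyMeasurable.smul (f := fun p : ℝ × ℝ =>
      (Ioc p.2 t).indicator (fun s => (t - s) ^ (α - 1) * (s - p.2) ^ (β - 1)) p.1)
      (g := fun p => f p.2) ?_ hf'.1.comp_snd
    refine Measurable.aestronglyMeasurable ?_
    have : (fun p : ℝ × ℝ =>
        (Ioc p.2 t).indicator (fun s => (t - s) ^ (α - 1) * (s - p.2) ^ (β - 1)) p.1)
        = {p : ℝ × ℝ | p.2 < p.1 ∧ p.1 ≤ t}.indicator
          (fun p => (t - p.1) ^ (α - 1) * (p.1 - p.2) ^ (β - 1)) := by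
      ext p; simp only [indicator, mem_Ioc, mem_ofPred_eq]
    rw [this]
    refine Measurable.indicator (by fun_prop) ?_
    exact (measurableSet_lt measurable_snd measurable_fst).inter
      (measurableSet_le measurable_fst measurable_const)
  have hsec : ∀ᵐ τ ∂(volume.restrict (Ioc 0 t)), τ ∈ Ioo 0 t := by
    rw [← Measure.restrict_congr_set Ioo_ae_eq_Ioc]
    exact ae_restrict_mem measurableSet_Ioo
  have hint : ∀ τ ∈ Ioo 0 t, Integrable ((Ioc τ t).indicator
      (fun s => (t - s) ^ (α - 1) * (s - τ) ^ (β - 1))) (volume.restrict (Ioc 0 t)) := by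
    intro τ hτ
    exact ((integrable_indicator_iff measurableSet_Ioc).2
      (integrableOn_beta_shift hα hβ hαβ hτ.2)).integrableOn
  rw [integrable_prod_iff' hmeas]
  constructor
  · filter_upwards [hsec] with τ hτ
    exact Integrable.smul_const (𝕜 := ℝ) (hint τ hτ) (f τ)
  · refine (hf'.norm.const_mul (Real.Gamma α * Real.Gamma β)).congr ?_
    filter_upwards [hsec] with τ hτ
    simp only [Function.uncurry, norm_smul]
    rw [integral_mul_const]
    congr 1
    rw [← integral_beta_shift hα hβ hαβ hτ.2, intervalIntegral.integral_of_le hτ.2.le]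
    have h1 : ∀ s, ‖(Ioc τ t).indicator (fun s => (t - s) ^ (α - 1) * (s - τ) ^ (β - 1)) s‖
        = (Ioc τ t).indicator (fun s => (t - s) ^ (α - 1) * (s - τ) ^ (β - 1)) s := by
      intro s
      refine Real.norm_of_nonneg (indicator_nonneg (fun s hs => ?_) s)
      have := sub_nonneg.2 hs.2
      have := sub_nonneg.2 hs.1.le
      positivity
    simp_rw [h1]
    rw [setIntegral_indicator measurableSet_Ioc,
      inter_eq_right.2 (Ioc_subset_Ioc_left hτ.1.le)]

theorem abelIntegral_abelIntegral [CompleteSpace E] {α β : ℝ} (hα : 0 < α) (hβ : 0 < β) (hαβ : α + β = 1)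
    {f : ℝ → E} {t : ℝ} (ht : 0 ≤ t) (hf : IntervalIntegrable f volume 0 t) :
    abelIntegral α (abelIntegral β f) t
      = (Real.Gamma α * Real.Gamma β) • ∫ s in (0 : ℝ)..t, f s := by
  have hswap := integral_integral_swap (integrable_abel_kernel_prod hα hβ hαβ ht hf)
  have hsec : ∀ᵐ τ ∂(volume.restrict (Ioc 0 t)), τ ∈ Ioo 0 t := by
    rw [← Measure.restrict_congr_set Ioo_ae_eq_Ioc]
    exact ae_restrict_mem measurableSet_Ioo
  have hL : ∫ s in Ioc 0 t, ∫ τ in Ioc 0 t,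
      (Ioc τ t).indicator (fun s => (t - s) ^ (α - 1) * (s - τ) ^ (β - 1)) s • f τ
      = abelIntegral α (abelIntegral β f) t := by
    rw [abelIntegral, intervalIntegral.integral_of_le ht]
    refine setIntegral_congr_fun measurableSet_Ioc fun s hs => ?_
    simp only [abelIntegral]
    rw [intervalIntegral.integral_of_le hs.1.le, ← integral_smul]
    have h2 : ∀ τ, (Ioc τ t).indicator (fun s => (t - s) ^ (α - 1) * (s - τ) ^ (β - 1)) s • f τ
        = (Iio s).indicator (fun τ => (t - s) ^ (α - 1) • (s - τ) ^ (β - 1) • f τ) τ := by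
      intro τ
      by_cases hτ : τ < s
      · rw [indicator_of_mem (show s ∈ Ioc τ t from ⟨hτ, hs.2⟩), indicator_of_mem (mem_Iio.2 hτ),
          mul_smul]
      · rw [indicator_of_notMem (fun h => hτ h.1), indicator_of_notMem (show τ ∉ Iio s from hτ), zero_smul]
    simp_rw [h2]
    rw [setIntegral_indicator measurableSet_Iio, setIntegral_congr_set Ioo_ae_eq_Ioc.symm]
    congr 2
    ext τ
    simp only [mem_inter_iff, mem_Ioc, mem_Iio, mem_Ioo]
    constructor
    · exact fun h => ⟨h.1.1, h.2⟩
    · exact fun h => ⟨⟨h.1, h.2.le.trans hs.2⟩, h.2⟩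
  have hR : ∫ τ in Ioc 0 t, ∫ s in Ioc 0 t,
      (Ioc τ t).indicator (fun s => (t - s) ^ (α - 1) * (s - τ) ^ (β - 1)) s • f τ
      = (Real.Gamma α * Real.Gamma β) • ∫ s in (0 : ℝ)..t, f s := by
    rw [intervalIntegral.integral_of_le ht, ← integral_smul]
    refine integral_congr_ae ?_
    filter_upwards [hsec] with τ hτ
    rw [integral_smul_const, setIntegral_indicator measurableSet_Ioc,
      inter_eq_right.2 (Ioc_subset_Ioc_left hτ.1.le), ← intervalIntegral.integral_of_le hτ.2.le,
      integral_beta_shift hα hβ hαβ hτ.2]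
  rw [← hL, hswap, hR]

end Semigroup

/-! ### Essentially bounded and Hölder functions. -/

section NormedGroup

variable {E : Type*} [NormedAddCommGroup E]

theorem exists_ae_norm_le_of_memLp_top {T : ℝ} {f : ℝ → E}
    (hf : MemLp f ⊤ (volume.restrict (Icc 0 T))) :
    ∃ M : ℝ, 0 ≤ M ∧ ∀ᵐ s, s ∈ Icc 0 T → ‖f s‖ ≤ M := by
  refine ⟨(eLpNorm f ⊤ (volume.restrict (Icc 0 T))).toReal, ENNReal.toReal_nonneg, ?_⟩
  rw [← ae_restrict_iff' measurableSet_Icc]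
  have h := ae_le_eLpNormEssSup (f := f) (μ := volume.restrict (Icc 0 T))
  filter_upwards [h] with s hs
  rw [← eLpNorm_exponent_top] at hs
  simpa using ENNReal.toReal_mono hf.2.ne hs

theorem continuousOn_of_holder {α C : ℝ} (hα : 0 < α) {s : Set ℝ} {f : ℝ → E}
    (h : ∀ a ∈ s, ∀ b ∈ s, a ≤ b → ‖f b - f a‖ ≤ C * (b - a) ^ α) : ContinuousOn f s := by
  intro a ha
  rw [ContinuousWithinAt, tendsto_iff_norm_sub_tendsto_zero]
  have h1 : Tendsto (fun b => C * |b - a| ^ α) (𝓝[s] a) (𝓝 0) := by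
    have : Continuous fun b : ℝ => C * |b - a| ^ α :=
      continuous_const.mul ((continuous_abs.comp (continuous_id.sub continuous_const)).rpow_const
        fun _ => Or.inr hα.le)
    have h2 := (this.tendsto a).mono_left (nhdsWithin_le_nhds (s := s))
    simpa [Real.zero_rpow hα.ne'] using h2
  refine squeeze_zero' (Eventually.of_forall fun _ => norm_nonneg _) ?_ h1
  filter_upwards [self_mem_nhdsWithin] with b hb
  rcases le_total a b with hab | hab
  · rw [abs_of_nonneg (by linarith)]; exact h a ha b hb hab
  · rw [abs_of_nonpos (by linarith), neg_sub, norm_sub_rev]; exact h b hb a ha hab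

theorem ContinuousOn.memLp_top_Icc {T : ℝ} {f : ℝ → E} (hf : ContinuousOn f (Icc 0 T)) :
    MemLp f ⊤ (volume.restrict (Icc 0 T)) := by
  obtain ⟨C, hC⟩ := isCompact_Icc.exists_bound_of_continuousOn hf
  refine MemLp.of_bound (hf.aestronglyMeasurable measurableSet_Icc) C ?_
  exact (ae_restrict_iff' measurableSet_Icc).2 (Eventually.of_forall hC)

theorem memLp_top_of_Icc {T a b : ℝ} (ha : 0 ≤ a) (hb : b ≤ T) {f : ℝ → E}
    (hf : MemLp f ⊤ (volume.restrict (Icc 0 T))) : MemLp f ⊤ (volume.restrict (Ioc a b)) :=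
  hf.mono_measure (Measure.restrict_mono
    (show Ioc a b ⊆ Icc 0 T from fun _ h => ⟨ha.trans h.1.le, h.2.trans hb⟩) le_rfl)

theorem intervalIntegrable_of_memLp_top {T a b : ℝ} (ha : 0 ≤ a) (hab : a ≤ b) (hb : b ≤ T)
    {f : ℝ → E} (hf : MemLp f ⊤ (volume.restrict (Icc 0 T))) :
    IntervalIntegrable f volume a b := by
  rw [intervalIntegrable_iff_integrableOn_Ioc_of_le hab]
  exact (memLp_top_of_Icc ha hb hf).integrable le_top

end NormedGroup

/-! ### Hölder regularity of `I^α φ`, and `D^α I^α φ = φ` almost everywhere. -/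

section EssentiallyBounded

variable {E : Type*} [NormedAddCommGroup E] [NormedSpace ℝ E]

theorem abelIntegral_smul (β c : ℝ) (f : ℝ → E) (t : ℝ) :
    abelIntegral β (fun s => c • f s) t = c • abelIntegral β f t := by
  simp only [abelIntegral, smul_comm _ c, intervalIntegral.integral_smul]

theorem abelIntegral_congr_ae {β : ℝ} {f g : ℝ → E} {t : ℝ} (ht : 0 ≤ t)
    (h : ∀ᵐ s, s ∈ Icc 0 t → f s = g s) : abelIntegral β f t = abelIntegral β g t := by
  refine intervalIntegral.integral_congr_ae ?_
  filter_upwards [h] with s hs hst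
  rw [uIoc_of_le ht] at hst
  rw [hs ⟨hst.1.le, hst.2⟩]

theorem rlIntegral_eq_abelIntegral {α : ℝ} (φ : ℝ → E) {t : ℝ} (ht : 0 ≤ t) :
    rlIntegral α φ t = (1 / Real.Gamma α) • abelIntegral α φ t := by
  rw [rlIntegral, abelIntegral]
  congr 1
  refine intervalIntegral.integral_congr fun τ hτ => ?_
  rw [uIcc_of_le ht] at hτ
  rw [one_div, ← Real.rpow_neg (by linarith [hτ.2]), neg_sub]

theorem rlKernelIntegral_eq_abelIntegral {α : ℝ} (x : ℝ → E) {s : ℝ} (hs : 0 ≤ s) :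
    rlKernelIntegral α x s = abelIntegral (1 - α) x s := by
  rw [rlKernelIntegral, abelIntegral]
  refine intervalIntegral.integral_congr fun τ hτ => ?_
  rw [uIcc_of_le hs] at hτ
  rw [one_div, ← Real.rpow_neg (by linarith [hτ.2])]
  ring_nf

theorem intervalIntegrable_smul_of_memLp_top {T a b : ℝ} (ha : 0 ≤ a) (hab : a ≤ b) (hb : b ≤ T)
    {f : ℝ → E} (hf : MemLp f ⊤ (volume.restrict (Icc 0 T))) {k : ℝ → ℝ}
    (hk : IntervalIntegrable k volume a b) :
    IntervalIntegrable (fun s => k s • f s) volume a b := by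
  rw [intervalIntegrable_iff_integrableOn_Ioc_of_le hab] at hk ⊢
  exact Integrable.smul_of_top_left hk (memLp_top_of_Icc ha hb hf)

/-- The new piece over `[s, t]` and the change of kernel over `[0, s]` each cost at most `M / α * (t
- s) ^ α`. For the second, the kernel decreases in time, so its difference has a sign and integrates
exactly. -/
theorem abelIntegral_sub_le {α T M : ℝ} (hα : α ∈ Ioo (0 : ℝ) 1) {f : ℝ → E}
    (hf : MemLp f ⊤ (volume.restrict (Icc 0 T))) (hM : 0 ≤ M)
    (hfM : ∀ᵐ s, s ∈ Icc 0 T → ‖f s‖ ≤ M) {s t : ℝ} (hs : 0 ≤ s) (hst : s ≤ t) (ht : t ≤ T) :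
    ‖abelIntegral α f t - abelIntegral α f s‖ ≤ 2 * M / α * (t - s) ^ α := by
  have hr : -1 < α - 1 := by linarith [hα.1]
  have hk := fun c a b => intervalIntegrable_sub_rpow hr c a b
  have i1 := intervalIntegrable_smul_of_memLp_top le_rfl hs (hst.trans ht) hf (hk t 0 s)
  have i2 := intervalIntegrable_smul_of_memLp_top hs hst ht hf (hk t s t)
  have i3 := intervalIntegrable_smul_of_memLp_top le_rfl hs (hst.trans ht) hf (hk s 0 s)
  have hsplit : abelIntegral α f t - abelIntegral α f s =
      (∫ τ in s..t, (t - τ) ^ (α - 1) • f τ) -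
        ∫ τ in (0 : ℝ)..s, ((s - τ) ^ (α - 1) - (t - τ) ^ (α - 1)) • f τ := by
    simp only [sub_smul]
    rw [abelIntegral, abelIntegral, ← intervalIntegral.integral_add_adjacent_intervals i1 i2,
      intervalIntegral.integral_sub i3 i1]
    abel
  have b1 : ‖∫ τ in s..t, (t - τ) ^ (α - 1) • f τ‖ ≤ M / α * (t - s) ^ α := by
    have : ∫ τ in s..t, M * (t - τ) ^ (α - 1) = M / α * (t - s) ^ α := by
      rw [intervalIntegral.integral_const_mul, integral_sub_rpow hα.1]
      simp [hα.1.ne']; ring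
    rw [← this]
    refine intervalIntegral.norm_integral_le_of_norm_le hst ?_ ((hk t s t).const_mul M)
    filter_upwards [hfM] with τ hτ hm
    rw [norm_smul, Real.norm_of_nonneg (Real.rpow_nonneg (by linarith [hm.2]) _), mul_comm]
    exact mul_le_mul_of_nonneg_right (hτ ⟨hs.trans hm.1.le, hm.2.trans ht⟩)
      (Real.rpow_nonneg (by linarith [hm.2]) _)
  have b2 : ‖∫ τ in (0 : ℝ)..s, ((s - τ) ^ (α - 1) - (t - τ) ^ (α - 1)) • f τ‖
      ≤ M / α * (t - s) ^ α := by
    have h1 : ∫ τ in (0 : ℝ)..s, M * ((s - τ) ^ (α - 1) - (t - τ) ^ (α - 1))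
        ≤ M / α * (t - s) ^ α := by
      rw [intervalIntegral.integral_const_mul, intervalIntegral.integral_sub (hk s 0 s) (hk t 0 s),
        integral_sub_rpow hα.1, integral_sub_rpow hα.1]
      have h3 : s ^ α ≤ t ^ α := Real.rpow_le_rpow hs hst hα.1.le
      simp only [sub_zero, sub_self, Real.zero_rpow hα.1.ne']
      rw [← sub_div, div_mul_eq_mul_div, ← mul_div_assoc]
      refine div_le_div_of_nonneg_right (mul_le_mul_of_nonneg_left (by linarith) hM) hα.1.le
    refine le_trans ?_ h1
    refine intervalIntegral.norm_integral_le_of_norm_le hs ?_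
      (((hk s 0 s).sub (hk t 0 s)).const_mul M)
    -- At `τ = s` the convention `0 ^ (α - 1) = 0` breaks the monotonicity of the kernel.
    have hne : ∀ᵐ τ : ℝ, τ ≠ s := by simp [ae_iff, measure_singleton]
    filter_upwards [hfM, hne] with τ hτ hne hm
    have hpos : 0 ≤ (s - τ) ^ (α - 1) - (t - τ) ^ (α - 1) := by
      rw [sub_nonneg]
      have : τ < s := lt_of_le_of_ne hm.2 hne
      exact Real.rpow_le_rpow_of_nonpos (by linarith) (by linarith) (by linarith [hα.2])
    rw [norm_smul, Real.norm_of_nonneg hpos, mul_comm]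
    exact mul_le_mul_of_nonneg_right (hτ ⟨hm.1.le, hm.2.trans (hst.trans ht)⟩) hpos
  rw [hsplit]
  refine (norm_sub_le _ _).trans ((add_le_add b1 b2).trans (le_of_eq ?_))
  ring

theorem continuousOn_abelIntegral {α T : ℝ} (hα : α ∈ Ioo (0 : ℝ) 1) {f : ℝ → E}
    (hf : MemLp f ⊤ (volume.restrict (Icc 0 T))) : ContinuousOn (abelIntegral α f) (Icc 0 T) := by
  obtain ⟨M, hM, hfM⟩ := exists_ae_norm_le_of_memLp_top hf
  exact continuousOn_of_holder hα.1 fun a ha b hb hab =>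
    abelIntegral_sub_le hα hf hM hfM ha.1 hab hb.2

/-- By the semigroup identity the kernel integral of `x` is `Γ(1 - α)` times the primitive of `φ`;
Lebesgue's differentiation theorem does the rest. -/
theorem ae_rlDeriv_eq [CompleteSpace E] {α T : ℝ} (hα : α ∈ Ioo (0 : ℝ) 1) (hT : 0 < T)
    {φ x : ℝ → E} (hφ : MemLp φ ⊤ (volume.restrict (Icc 0 T)))
    (hx : ∀ t ∈ Icc 0 T, x t = rlIntegral α φ t) :
    ∀ᵐ t ∂(volume.restrict (Icc 0 T)), RLDifferentiableAt T α x t ∧ rlDeriv T α x t = φ t := by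
  have hα' : 0 < 1 - α := by linarith [hα.2]
  have hΓ : 0 < Real.Gamma (1 - α) := Real.Gamma_pos_of_pos hα'
  have hΓ' : 0 < Real.Gamma α := Real.Gamma_pos_of_pos hα.1
  have hx' : ∀ t ∈ Icc 0 T, x t = (1 / Real.Gamma α) • abelIntegral α φ t := fun t ht => by
    rw [hx t ht, rlIntegral_eq_abelIntegral φ ht.1]
  have hxc : ContinuousOn x (Icc 0 T) :=
    ((continuousOn_abelIntegral hα hφ).const_smul (1 / Real.Gamma α)).congr hx'
  have hint : ∀ s ∈ Icc 0 T,
      IntervalIntegrable (fun τ => (1 / (s - τ) ^ α) • x τ) volume 0 s := by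
    intro s hs
    refine intervalIntegrable_smul_of_memLp_top le_rfl hs.1 hs.2 hxc.memLp_top_Icc ?_
    refine (intervalIntegrable_sub_rpow (r := -α) (by linarith [hα.2]) s 0 s).congr fun τ hτ => ?_
    rw [uIoc_of_le hs.1] at hτ
    rw [one_div, Real.rpow_neg (by linarith [hτ.2])]
  have hker : ∀ s ∈ Icc 0 T,
      rlKernelIntegral α x s = Real.Gamma (1 - α) • ∫ τ in (0 : ℝ)..s, φ τ := by
    intro s hs
    have h1 : abelIntegral (1 - α) x s
        = abelIntegral (1 - α) (fun t => (1 / Real.Gamma α) • abelIntegral α φ t) s :=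
      abelIntegral_congr_ae hs.1
        (Eventually.of_forall fun τ hτ => hx' τ ⟨hτ.1, hτ.2.trans hs.2⟩)
    rw [rlKernelIntegral_eq_abelIntegral x hs.1, h1, abelIntegral_smul,
      abelIntegral_abelIntegral hα' hα.1 (by ring) hs.1
        (intervalIntegrable_of_memLp_top le_rfl hs.1 hs.2 hφ), smul_smul]
    congr 1
    field_simp
  have hLeb := (intervalIntegrable_of_memLp_top le_rfl hT.le le_rfl hφ).ae_hasDerivAt_integral
  rw [ae_restrict_iff' measurableSet_Icc]
  filter_upwards [hLeb] with t ht htT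
  have hd := ((ht (by rwa [uIcc_of_le hT.le]) 0 left_mem_uIcc).const_smul
    (Real.Gamma (1 - α))).hasDerivWithinAt (s := Icc 0 T)
  have hd' := hd.congr (f₁ := rlKernelIntegral α x) hker (hker t htT)
  refine ⟨⟨hint, hd'.differentiableWithinAt⟩, ?_⟩
  rw [rlDeriv, hd'.derivWithin (uniqueDiffOn_Icc hT t htT), smul_smul,
    one_div_mul_cancel hΓ.ne', one_smul]

end EssentiallyBounded

/-! ### Bregman distance and the chain rule with remainder for `C¹` paths. -/

section Bregman

variable {E : Type*} [NormedAddCommGroup E] [InnerProductSpace ℝ E] [CompleteSpace E]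

/-- The Bregman distance `V(v) - V(u) - ⟨∇V(u), v - u⟩`. -/
noncomputable def bregman (V : E → ℝ) (u v : E) : ℝ :=
  V v - V u - inner ℝ (gradient V u) (v - u)

theorem hasDerivAt_comp_of_gradient {V : E → ℝ} (hd : Differentiable ℝ V) {z : ℝ → E} {z' : E}
    {τ : ℝ} (hz : HasDerivAt z z' τ) :
    HasDerivAt (fun s => V (z s)) (inner ℝ (gradient V (z τ)) z') τ := by
  have h := (hd (z τ)).hasGradientAt.hasFDerivAt.comp_hasDerivAt τ hz
  rwa [InnerProductSpace.toDual_apply_apply] at h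

theorem bregman_nonneg {V : E → ℝ} (hV : ConvexOn ℝ univ V) (hd : Differentiable ℝ V) (u v : E) :
    0 ≤ bregman V u v := by
  have hline : HasDerivAt (fun s : ℝ => u + s • (v - u)) (v - u) 0 := by
    simpa using ((hasDerivAt_id (0 : ℝ)).smul_const (v - u)).const_add u
  have hg : HasDerivAt (fun s : ℝ => V (u + s • (v - u))) (inner ℝ (gradient V u) (v - u)) 0 := by
    simpa only [zero_smul, add_zero] using hasDerivAt_comp_of_gradient hd hline
  have hconv : ConvexOn ℝ univ (fun s : ℝ => V (u + s • (v - u))) := by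
    have h2 := hV.comp_affineMap (AffineMap.lineMap u v : ℝ →ᵃ[ℝ] E)
    refine (h2.congr fun s _ => ?_)
    simp [AffineMap.lineMap_apply, add_comm]
  have h3 := hconv.le_slope_of_hasDerivAt (mem_univ 0) (mem_univ 1) one_pos hg
  simp only [slope_def_field, one_smul, zero_smul, add_zero, sub_zero, div_one,
    add_sub_cancel] at h3
  rw [bregman]
  linarith

/-- Mean value inequality on the segment from `u` to `v`, which stays in the ball. The sharp factor
`1 / 2` is not needed. -/
theorem bregman_le {V : E → ℝ} (hd : Differentiable ℝ V) {r L : ℝ}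
    (hL : 0 ≤ L)
    (hV : ∀ u ∈ Metric.closedBall (0 : E) r, ∀ v ∈ Metric.closedBall (0 : E) r,
      ‖gradient V u - gradient V v‖ ≤ L * ‖u - v‖)
    {u v : E} (hu : u ∈ Metric.closedBall (0 : E) r) (hv : v ∈ Metric.closedBall (0 : E) r) :
    bregman V u v ≤ L * ‖v - u‖ ^ 2 := by
  have h := Convex.norm_image_sub_le_of_norm_fderiv_le' (𝕜 := ℝ) (f := V) (s := segment ℝ u v)
    (φ := InnerProductSpace.toDual ℝ E (gradient V u)) (C := L * ‖v - u‖) (x := u) (y := v)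
    (fun w _ => hd w) ?_ (convex_segment u v) (left_mem_segment ℝ u v) (right_mem_segment ℝ u v)
  · rw [InnerProductSpace.toDual_apply_apply] at h
    calc bregman V u v ≤ ‖V v - V u - inner ℝ (gradient V u) (v - u)‖ := le_abs_self _
      _ ≤ L * ‖v - u‖ * ‖v - u‖ := h
      _ = L * ‖v - u‖ ^ 2 := by ring
  · intro w hw
    have hwr : w ∈ Metric.closedBall (0 : E) r :=
      (convex_closedBall (0 : E) r).segment_subset hu hv hw
    have hn : ‖w - u‖ ≤ ‖v - u‖ := norm_sub_le_of_mem_segment hw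
    rw [← toDual_gradient, ← map_sub, LinearIsometryEquiv.norm_map]
    exact (hV w hwr u hu).trans (mul_le_mul_of_nonneg_left hn hL)

theorem continuous_gradient_of_lipschitz_on_balls {V : E → ℝ}
    (hV : ∀ r : ℝ, 0 ≤ r → ∃ L : ℝ, 0 < L ∧ ∀ u ∈ Metric.closedBall (0 : E) r,
      ∀ v ∈ Metric.closedBall (0 : E) r, ‖gradient V u - gradient V v‖ ≤ L * ‖u - v‖) :
    Continuous (gradient V) := by
  rw [continuous_iff_continuousAt]
  intro u
  obtain ⟨L, hL, h⟩ := hV (‖u‖ + 1) (by positivity)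
  have hlip : LipschitzOnWith L.toNNReal (gradient V) (Metric.closedBall (0 : E) (‖u‖ + 1)) := by
    refine LipschitzOnWith.of_dist_le_mul fun a ha b hb => ?_
    rw [dist_eq_norm, dist_eq_norm, Real.coe_toNNReal _ hL.le]
    exact h a ha b hb
  refine hlip.continuousOn.continuousAt ?_
  refine mem_of_superset (Metric.ball_mem_nhds u one_pos) fun w hw => ?_
  rw [mem_closedBall_zero_iff]
  rw [mem_ball_iff_norm] at hw
  have := norm_le_insert' w u
  linarith

theorem continuous_bregman {V : E → ℝ} (hd : Differentiable ℝ V) (hg : Continuous (gradient V)) :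
    Continuous fun p : E × E => bregman V p.1 p.2 := by
  have hc := hd.continuous
  unfold bregman
  fun_prop

theorem hasDerivAt_bregman_comp {V : E → ℝ} (hd : Differentiable ℝ V) (u : E) {z : ℝ → E} {z' : E}
    {τ : ℝ} (hz : HasDerivAt z z' τ) :
    HasDerivAt (fun τ => bregman V u (z τ)) (inner ℝ (gradient V (z τ) - gradient V u) z') τ := by
  have h1 := hasDerivAt_comp_of_gradient hd hz
  have h2 : HasDerivAt (fun τ => inner ℝ (gradient V u) (z τ - u)) (inner ℝ (gradient V u) z') τ := by
    simpa using (hasDerivAt_const τ (gradient V u)).inner ℝ (hz.sub_const u)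
  rw [inner_sub_left]
  exact (h1.sub_const _).sub h2

/-- The nonnegative term subtracted in the chain rule for the fractional derivative of `V ∘ z`. -/
noncomputable def bregmanCorrection (α : ℝ) (V : E → ℝ) (z : ℝ → E) (t : ℝ) : ℝ :=
  t ^ (-α) * bregman V (z t) 0 + α * ∫ τ in (0 : ℝ)..t, (t - τ) ^ (-α - 1) * bregman V (z t) (z τ)

theorem norm_sub_rpow_mul_le {α t τ B g : ℝ} (hτ : τ < t)
    (hg : g ∈ Icc 0 (B * (t - τ) ^ (2 * α))) :
    ‖(t - τ) ^ (-α - 1) * g‖ ≤ B * (t - τ) ^ (α - 1) := by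
  have h0 := Real.rpow_nonneg (sub_nonneg.2 hτ.le) (-α - 1)
  rw [Real.norm_of_nonneg (mul_nonneg h0 hg.1)]
  calc (t - τ) ^ (-α - 1) * g ≤ (t - τ) ^ (-α - 1) * (B * (t - τ) ^ (2 * α)) :=
        mul_le_mul_of_nonneg_left hg.2 h0
    _ = B * ((t - τ) ^ (-α - 1) * (t - τ) ^ (2 * α)) := by ring
    _ = B * (t - τ) ^ (α - 1) := by
      rw [← Real.rpow_add (by linarith)]; ring_nf

theorem intervalIntegrable_sub_rpow_mul {α t B : ℝ} (hα : 0 < α) (ht : 0 < t) {g : ℝ → ℝ}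
    (hgc : Continuous g) (hg : ∀ τ ∈ Icc 0 t, g τ ∈ Icc 0 (B * (t - τ) ^ (2 * α))) :
    IntervalIntegrable (fun τ => (t - τ) ^ (-α - 1) * g τ) volume 0 t := by
  have h := (intervalIntegrable_sub_rpow (r := α - 1) (by linarith) t 0 t).const_mul B
  refine h.mono_fun' ?_ ?_
  · exact (Measurable.mul (by fun_prop) hgc.measurable).aestronglyMeasurable
  · have hne : ∀ᵐ τ ∂volume.restrict (uIoc 0 t), τ ≠ t :=
      ae_restrict_of_ae (by simp [ae_iff, measure_singleton])
    filter_upwards [hne, ae_restrict_mem measurableSet_uIoc] with τ hτ hm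
    rw [uIoc_of_le ht.le] at hm
    exact norm_sub_rpow_mul_le (lt_of_le_of_ne hm.2 hτ) (hg τ ⟨hm.1.le, hm.2⟩)

/-- Integration by parts, with `bregman V (z t) (z τ)` serving as the primitive of `⟨∇V(z τ) - ∇V(z
t), z' τ⟩`. Unlike `V (z τ)` it vanishes to order `2α` at `τ = t`, which kills the singular boundary
term there. -/
theorem abelIntegral_inner_gradient {α t B : ℝ} (hα : α ∈ Ioo (0 : ℝ) 1) (ht : 0 < t) {V : E → ℝ}
    (hd : Differentiable ℝ V) (hgrad : Continuous (gradient V)) {z z' : ℝ → E}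
    (hz : ∀ s, HasDerivAt z (z' s) s) (hz' : Continuous z') (hz0 : z 0 = 0)
    (hB : ∀ τ ∈ Icc 0 t, bregman V (z t) (z τ) ∈ Icc 0 (B * (t - τ) ^ (2 * α))) :
    abelIntegral (1 - α) (fun s => inner ℝ (gradient V (z s)) (z' s)) t
      = inner ℝ (gradient V (z t)) (abelIntegral (1 - α) z' t) - bregmanCorrection α V z t := by
  have hzc : Continuous z := continuous_iff_continuousAt.2 fun s => (hz s).continuousAt
  have hk : IntervalIntegrable (fun s => (t - s) ^ (-α)) volume 0 t :=
    intervalIntegrable_sub_rpow (by linarith [hα.2]) t 0 t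
  have hgc : Continuous fun τ => bregman V (z t) (z τ) :=
    (continuous_bregman hd hgrad).comp (continuous_const.prodMk hzc)
  have hgz : Continuous fun s => gradient V (z s) := hgrad.comp hzc
  have i1 := intervalIntegrable_sub_rpow_mul hα.1 ht hgc hB
  have i2 : IntervalIntegrable (fun s => (t - s) ^ (-α) *
      inner ℝ (gradient V (z s) - gradient V (z t)) (z' s)) volume 0 t :=
    hk.mul_continuousOn (by fun_prop)
  have i3 : IntervalIntegrable (fun s => (t - s) ^ (-α) * inner ℝ (gradient V (z s)) (z' s))
      volume 0 t := hk.mul_continuousOn (by fun_prop)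
  have i4 : IntervalIntegrable (fun s => (t - s) ^ (-α) • z' s) volume 0 t :=
    hk.smul_continuousOn (by fun_prop)
  have hderiv : ∀ τ ∈ Ioo 0 t, HasDerivAt (fun τ => (t - τ) ^ (-α) * bregman V (z t) (z τ))
      (α * ((t - τ) ^ (-α - 1) * bregman V (z t) (z τ)) +
        (t - τ) ^ (-α) * inner ℝ (gradient V (z τ) - gradient V (z t)) (z' τ)) τ := by
    intro τ hτ
    have h1 := ((hasDerivAt_id τ).const_sub t).rpow_const (p := -α)
      (Or.inl (sub_pos.2 hτ.2).ne')
    have h2 := h1.mul (hasDerivAt_bregman_comp hd (z t) (hz τ))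
    refine h2.congr_deriv ?_
    simp only [id]
    ring
  have hleft : Tendsto (fun τ => (t - τ) ^ (-α) * bregman V (z t) (z τ)) (𝓝[>] 0)
      (𝓝 (t ^ (-α) * bregman V (z t) 0)) := by
    have hc : ContinuousAt (fun τ => (t - τ) ^ (-α) * bregman V (z t) (z τ)) 0 := by
      refine ContinuousAt.mul (ContinuousAt.rpow_const (by fun_prop) (Or.inl ?_)) hgc.continuousAt
      simpa using ht.ne'
    have := hc.tendsto
    simp only [sub_zero, hz0] at this
    exact this.mono_left nhdsWithin_le_nhds
  have hright : Tendsto (fun τ => (t - τ) ^ (-α) * bregman V (z t) (z τ)) (𝓝[<] t) (𝓝 0) := by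
    have hc : Continuous fun τ => B * (t - τ) ^ α :=
      continuous_const.mul ((continuous_const.sub continuous_id).rpow_const
        fun _ => Or.inr hα.1.le)
    have hc' := (hc.tendsto t).mono_left (nhdsWithin_le_nhds (s := Iio t))
    rw [sub_self, Real.zero_rpow hα.1.ne', mul_zero] at hc'
    have hmem : ∀ᶠ τ in 𝓝[<] t, τ ∈ Ioo 0 t := Ioo_mem_nhdsLT ht
    refine squeeze_zero' ?_ ?_ hc'
    · filter_upwards [hmem] with τ hτ
      exact mul_nonneg (Real.rpow_nonneg (by linarith [hτ.2]) _) (hB τ ⟨hτ.1.le, hτ.2.le⟩).1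
    · filter_upwards [hmem] with τ hτ
      calc (t - τ) ^ (-α) * bregman V (z t) (z τ) ≤ (t - τ) ^ (-α) * (B * (t - τ) ^ (2 * α)) :=
            mul_le_mul_of_nonneg_left (hB τ ⟨hτ.1.le, hτ.2.le⟩).2
              (Real.rpow_nonneg (by linarith [hτ.2]) _)
        _ = B * ((t - τ) ^ (-α) * (t - τ) ^ (2 * α)) := by ring
        _ = B * (t - τ) ^ α := by
          rw [← Real.rpow_add (by linarith [hτ.2])]; ring_nf
  have hftc := intervalIntegral.integral_eq_sub_of_hasDerivAt_of_tendsto ht hderiv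
    ((i1.const_mul α).add i2) hleft hright
  rw [intervalIntegral.integral_add (i1.const_mul α) i2, intervalIntegral.integral_const_mul]
    at hftc
  have hi : inner ℝ (gradient V (z t)) (abelIntegral (1 - α) z' t)
      = ∫ s in (0 : ℝ)..t, (t - s) ^ (-α) * inner ℝ (gradient V (z t)) (z' s) := by
    have h1 := (innerSL ℝ (gradient V (z t))).intervalIntegral_comp_comm i4
    simp only [innerSL_apply_apply, inner_smul_right] at h1
    rw [h1, abelIntegral]
    ring_nf
  have hs : ∫ s in (0 : ℝ)..t,
      (t - s) ^ (-α) * inner ℝ (gradient V (z s) - gradient V (z t)) (z' s)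
      = abelIntegral (1 - α) (fun s => inner ℝ (gradient V (z s)) (z' s)) t
        - inner ℝ (gradient V (z t)) (abelIntegral (1 - α) z' t) := by
    have i5 : IntervalIntegrable (fun s => (t - s) ^ (-α) * inner ℝ (gradient V (z t)) (z' s))
      volume 0 t := hk.mul_continuousOn (by fun_prop)
    rw [hi, abelIntegral]
    simp only [inner_sub_left, mul_sub, smul_eq_mul]
    rw [intervalIntegral.integral_sub i3 i5]
    ring_nf
  rw [hs] at hftc
  rw [bregmanCorrection]
  linarith

/-- The boundary term and the integral term each contribute at most `B * t ^ α`. -/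
theorem bregmanCorrection_mem_Icc {α t B : ℝ} (hα : 0 < α) (ht : 0 < t) {V : E → ℝ}
    (hd : Differentiable ℝ V) (hgrad : Continuous (gradient V)) {z : ℝ → E} (hz : Continuous z)
    (hz0 : z 0 = 0)
    (hB : ∀ τ ∈ Icc 0 t, bregman V (z t) (z τ) ∈ Icc 0 (B * (t - τ) ^ (2 * α))) :
    bregmanCorrection α V z t ∈ Icc 0 (2 * B * t ^ α) := by
  have hgc : Continuous fun τ => bregman V (z t) (z τ) :=
    (continuous_bregman hd hgrad).comp (continuous_const.prodMk hz)
  have i1 := intervalIntegrable_sub_rpow_mul hα ht hgc hB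
  have h0 := hB 0 ⟨le_rfl, ht.le⟩
  rw [hz0, sub_zero] at h0
  have htα := Real.rpow_nonneg ht.le (-α)
  constructor
  · refine add_nonneg (mul_nonneg htα h0.1) (mul_nonneg hα.le ?_)
    exact intervalIntegral.integral_nonneg ht.le fun τ hτ =>
      mul_nonneg (Real.rpow_nonneg (by linarith [hτ.2]) _) (hB τ hτ).1
  · have e1 : t ^ (-α) * bregman V (z t) 0 ≤ B * t ^ α :=
      calc t ^ (-α) * bregman V (z t) 0 ≤ t ^ (-α) * (B * t ^ (2 * α)) :=
            mul_le_mul_of_nonneg_left h0.2 htα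
        _ = B * (t ^ (-α) * t ^ (2 * α)) := by ring
        _ = B * t ^ α := by rw [← Real.rpow_add ht]; ring_nf
    have e2 : ∫ τ in (0 : ℝ)..t, (t - τ) ^ (-α - 1) * bregman V (z t) (z τ) ≤ B * (t ^ α / α) := by
      have h3 : ∫ τ in (0 : ℝ)..t, B * (t - τ) ^ (α - 1) = B * (t ^ α / α) := by
        rw [intervalIntegral.integral_const_mul, integral_sub_rpow hα]
        simp [hα.ne']
      rw [← h3]
      refine intervalIntegral.integral_mono_on_of_le_Ioo ht.le i1
        ((intervalIntegrable_sub_rpow (by linarith) t 0 t).const_mul B) fun τ hτ => ?_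
      exact (le_abs_self _).trans (norm_sub_rpow_mul_le hτ.2 (hB τ ⟨hτ.1.le, hτ.2.le⟩))
    have e3 := mul_le_mul_of_nonneg_left e2 hα.le
    have e4 : α * (B * (t ^ α / α)) = B * t ^ α := by field_simp
    rw [bregmanCorrection]
    linarith

/-- Dominated convergence: a constant `B` independent of `i` gives the common integrable majorant `B
* (t - τ) ^ (α - 1)`. -/
theorem tendsto_bregmanCorrection {ι : Type*} {l : Filter ι} [l.IsCountablyGenerated]
    {α t B : ℝ} (hα : 0 < α) (ht : 0 < t) {V : E → ℝ}
    (hd : Differentiable ℝ V) (hgrad : Continuous (gradient V)) {z : ι → ℝ → E} {x : ℝ → E}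
    (hz : ∀ᶠ i in l, Continuous (z i)) (hlim : ∀ τ ∈ Icc 0 t, Tendsto (fun i => z i τ) l (𝓝 (x τ)))
    (hB : ∀ᶠ i in l, ∀ τ ∈ Icc 0 t,
      bregman V (z i t) (z i τ) ∈ Icc 0 (B * (t - τ) ^ (2 * α))) :
    Tendsto (fun i => bregmanCorrection α V (z i) t) l (𝓝 (bregmanCorrection α V x t)) := by
  have hcb := continuous_bregman hd hgrad
  have hl : ∀ {v : ι → E} {w : E}, Tendsto v l (𝓝 w) →
      Tendsto (fun i => bregman V (z i t) (v i)) l (𝓝 (bregman V (x t) w)) := fun hv =>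
    (hcb.tendsto _).comp ((hlim t ⟨ht.le, le_rfl⟩).prodMk_nhds hv)
  have hne : ∀ᵐ τ : ℝ, τ ≠ t := by simp [ae_iff, measure_singleton]
  refine Tendsto.add ((hl tendsto_const_nhds).const_mul _) (Tendsto.const_mul _ ?_)
  refine intervalIntegral.tendsto_integral_filter_of_dominated_convergence
    (fun τ => B * (t - τ) ^ (α - 1)) ?_ ?_
    ((intervalIntegrable_sub_rpow (by linarith) t 0 t).const_mul B) ?_
  · filter_upwards [hz] with i hi
    exact (Measurable.mul (by fun_prop)
      (hcb.comp (continuous_const.prodMk hi)).measurable).aestronglyMeasurable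
  · filter_upwards [hB] with i hi
    filter_upwards [hne] with τ hτ hm
    rw [uIoc_of_le ht.le] at hm
    exact norm_sub_rpow_mul_le (lt_of_le_of_ne hm.2 hτ) (hi τ ⟨hm.1.le, hm.2⟩)
  · refine Eventually.of_forall fun τ hm => ?_
    rw [uIoc_of_le ht.le] at hm
    exact (hl (hlim τ ⟨hm.1.le, hm.2⟩)).const_mul _

end Bregman

/-! ### Backward averages as `C¹` approximations. -/

section MovingAverage

variable {E : Type*} [NormedAddCommGroup E] [NormedSpace ℝ E]

/-- The average of `f` over the interval `[t - h, t]`. -/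
noncomputable def movingAverage (h : ℝ) (f : ℝ → E) (t : ℝ) : E :=
  h⁻¹ • ∫ s in (t - h)..t, f s

theorem movingAverage_eq_sub {f : ℝ → E} (hf : ∀ a b, IntervalIntegrable f volume a b) (h t : ℝ) :
    movingAverage h f t = h⁻¹ • ((∫ s in (0 : ℝ)..t, f s) - ∫ s in (0 : ℝ)..(t - h), f s) := by
  rw [movingAverage, intervalIntegral.integral_interval_sub_left (hf _ _) (hf _ _)]

theorem hasDerivAt_movingAverage [CompleteSpace E] {f : ℝ → E} (hf : Continuous f) (h t : ℝ) :
    HasDerivAt (movingAverage h f) (h⁻¹ • (f t - f (t - h))) t := by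
  have hF : ∀ t, HasDerivAt (fun t => ∫ s in (0 : ℝ)..t, f s) (f t) t := fun t =>
    hf.integral_hasStrictDerivAt 0 t |>.hasDerivAt
  have h1 := ((hF t).sub ((hF (t - h)).comp_sub_const t h)).const_smul h⁻¹
  refine h1.congr_of_eventuallyEq (Eventually.of_forall fun s => ?_)
  exact movingAverage_eq_sub (fun a b => hf.intervalIntegrable a b) h s

theorem tendsto_movingAverage {f : ℝ → E} (hf : ∀ a b, IntervalIntegrable f volume a b) {t : ℝ}
    {y : E} (ht : HasDerivAt (fun t => ∫ s in (0 : ℝ)..t, f s) y t) :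
    Tendsto (fun h => movingAverage h f t) (𝓝[>] 0) (𝓝 y) := by
  have h1 := hasDerivAt_iff_tendsto_slope_zero.1 ht
  have h2 : Tendsto (fun h : ℝ => -h) (𝓝[>] 0) (𝓝[≠] 0) := by
    refine tendsto_nhdsWithin_iff.2 ⟨?_, ?_⟩
    · have := (continuous_neg (G := ℝ)).tendsto 0
      rw [neg_zero] at this
      exact this.mono_left nhdsWithin_le_nhds
    · filter_upwards [self_mem_nhdsWithin] with h hh
      exact neg_ne_zero.2 (ne_of_gt hh)
  refine (h1.comp h2).congr fun h => ?_
  rw [movingAverage_eq_sub hf, Function.comp_apply, inv_neg, neg_smul, ← smul_neg, neg_sub,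
    sub_eq_add_neg t h]

theorem norm_movingAverage_le {f : ℝ → E} {h t M : ℝ} (hh : 0 < h)
    (hf : ∀ s, ‖f s‖ ≤ M) : ‖movingAverage h f t‖ ≤ M := by
  have h1 := intervalIntegral.norm_integral_le_of_norm_le_const (a := t - h) (b := t) (f := f)
    fun s _ => hf s
  rw [sub_sub_cancel, abs_of_pos hh] at h1
  rw [movingAverage, norm_smul, norm_inv, Real.norm_of_nonneg hh.le, inv_mul_le_iff₀ hh]
  linarith

theorem movingAverage_zero {f : ℝ → E} (hf : ∀ s ≤ 0, f s = 0) {h : ℝ} (hh : 0 < h) :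
    movingAverage h f 0 = 0 := by
  have : ∫ s in (0 - h)..0, f s = ∫ s in (0 - h)..0, (0 : E) := by
    refine intervalIntegral.integral_congr fun s hs => ?_
    rw [uIcc_of_le (by linarith)] at hs
    exact hf s hs.2
  rw [movingAverage, this, intervalIntegral.integral_zero, smul_zero]

/-- The average is a mean of translates of `f`, all sharing the same Hölder bound. -/
theorem norm_movingAverage_sub_le {f : ℝ → E} (hf : Continuous f) {h C α : ℝ} (hh : 0 < h)
    (hC : ∀ s t, s ≤ t → ‖f t - f s‖ ≤ C * (t - s) ^ α) {s t : ℝ} (hst : s ≤ t) :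
    ‖movingAverage h f t - movingAverage h f s‖ ≤ C * (t - s) ^ α := by
  have hrep : ∀ t, movingAverage h f t = h⁻¹ • ∫ u in (0 : ℝ)..h, f (t - u) := fun t => by
    rw [movingAverage, intervalIntegral.integral_comp_sub_left, sub_zero]
  have hi : ∀ t, IntervalIntegrable (fun u => f (t - u)) volume 0 h := fun t =>
    (hf.comp (continuous_const.sub continuous_id)).intervalIntegrable 0 h
  have h1 := intervalIntegral.norm_integral_le_of_norm_le_const (a := 0) (b := h)
    (f := fun u => f (t - u) - f (s - u)) (C := C * (t - s) ^ α)
    fun u _ => by simpa using hC (s - u) (t - u) (by linarith)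
  rw [sub_zero, abs_of_pos hh] at h1
  rw [hrep, hrep, ← smul_sub, ← intervalIntegral.integral_sub (hi t) (hi s), norm_smul, norm_inv,
    Real.norm_of_nonneg hh.le, inv_mul_le_iff₀ hh]
  linarith

end MovingAverage

/-! ### Abel integrals of functions vanishing at nonpositive times. -/

section Causal

variable {E : Type*} [NormedAddCommGroup E] [NormedSpace ℝ E]

theorem integral_eq_zero_of_nonpos {f : ℝ → E} (hf : ∀ s ≤ 0, f s = 0) {a b : ℝ} (ha : a ≤ 0)
    (hb : b ≤ 0) : ∫ s in a..b, f s = 0 := by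
  rw [intervalIntegral.integral_congr (g := fun _ => (0 : E)) fun s hs => hf s ?_,
    intervalIntegral.integral_zero]
  exact hs.2.trans (max_le ha hb)

theorem abelIntegral_of_nonpos {β : ℝ} {f : ℝ → E} (hf : ∀ s ≤ 0, f s = 0) {t : ℝ} (ht : t ≤ 0) :
    abelIntegral β f t = 0 :=
  integral_eq_zero_of_nonpos (fun s hs => by rw [hf s hs, smul_zero]) le_rfl ht

/-- Causality is what makes the Abel integral commute with a delay: the part over `[-h, 0]`
contributes nothing. -/
theorem abelIntegral_comp_sub_const {β : ℝ} (hβ : 0 < β) {f : ℝ → E} (hf : ∀ s ≤ 0, f s = 0)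
    (hfc : Continuous f) {h : ℝ} (hh : 0 ≤ h) (t : ℝ) :
    abelIntegral β (fun s => f (s - h)) t = abelIntegral β f (t - h) := by
  have h1 := intervalIntegral.integral_comp_sub_right
    (fun u => (t - h - u) ^ (β - 1) • f u) (a := 0) (b := t) h
  simp only [sub_sub_sub_cancel_right, zero_sub] at h1
  have hi : ∀ a b, IntervalIntegrable (fun u => (t - h - u) ^ (β - 1) • f u) volume a b :=
    fun a b => (intervalIntegrable_sub_rpow (by linarith) _ a b).smul_continuousOn hfc.continuousOn
  rw [abelIntegral, h1, ← intervalIntegral.integral_add_adjacent_intervals (hi (-h) 0) (hi 0 _),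
    integral_eq_zero_of_nonpos (fun s hs => by rw [hf s hs, smul_zero]) (by linarith) le_rfl,
    zero_add, abelIntegral]

theorem abelIntegral_abelIntegral_of_causal [CompleteSpace E] {α β : ℝ} (hα : 0 < α) (hβ : 0 < β)
    (hαβ : α + β = 1) {f : ℝ → E} (hf : ∀ s ≤ 0, f s = 0)
    (hi : ∀ a b, IntervalIntegrable f volume a b) (t : ℝ) :
    abelIntegral α (abelIntegral β f) t
      = (Real.Gamma α * Real.Gamma β) • ∫ s in (0 : ℝ)..t, f s := by
  rcases le_total 0 t with ht | ht
  · exact abelIntegral_abelIntegral hα hβ hαβ ht (hi 0 t)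
  · rw [abelIntegral_of_nonpos (fun s hs => abelIntegral_of_nonpos hf hs) ht,
      integral_eq_zero_of_nonpos hf le_rfl ht, smul_zero]

/-- The bound is needed on the whole line, since backward averages near time `0` look at negative
times. -/
theorem abelIntegral_sub_le_of_causal {α M : ℝ} (hα : α ∈ Ioo (0 : ℝ) 1) {f : ℝ → E}
    (hf : ∀ s ≤ 0, f s = 0) (hm : StronglyMeasurable f) (hM : ∀ s, ‖f s‖ ≤ M) {s t : ℝ}
    (hst : s ≤ t) : ‖abelIntegral α f t - abelIntegral α f s‖ ≤ 2 * M / α * (t - s) ^ α := by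
  have hM0 : 0 ≤ M := (norm_nonneg _).trans (hM 0)
  have hα0 := hα.1
  have hmem : MemLp f ⊤ (volume.restrict (Icc 0 t)) :=
    MemLp.of_bound hm.aestronglyMeasurable M (Eventually.of_forall hM)
  have key : ∀ a, 0 ≤ a → a ≤ t →
      ‖abelIntegral α f t - abelIntegral α f a‖ ≤ 2 * M / α * (t - a) ^ α := fun a ha hat =>
    abelIntegral_sub_le hα hmem hM0 (Eventually.of_forall fun s _ => hM s) ha hat le_rfl
  rcases le_total 0 s with hs | hs
  · exact key s hs hst
  rcases le_total 0 t with ht | ht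
  · have h0 := key 0 le_rfl ht
    rw [abelIntegral_of_nonpos hf le_rfl] at h0
    rw [abelIntegral_of_nonpos hf hs]
    refine h0.trans (mul_le_mul_of_nonneg_left ?_ (by positivity))
    exact Real.rpow_le_rpow (by linarith) (by linarith) hα0.le
  · rw [abelIntegral_of_nonpos hf hs, abelIntegral_of_nonpos hf ht, sub_zero, norm_zero]
    have := Real.rpow_nonneg (sub_nonneg.2 hst) α
    positivity

end Causal

/-! ### Fractional derivative of the averaged path. -/

section Smoothing

variable {E : Type*} [NormedAddCommGroup E] [NormedSpace ℝ E] [CompleteSpace E]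

/-- The derivative of an average is a difference quotient of `x`. Commuting the delay with the Abel
integral leaves a difference of primitives of `φ`, that is, an average of `φ`. -/
theorem abelIntegral_deriv_movingAverage {α : ℝ} (hα : α ∈ Ioo (0 : ℝ) 1) {φ x : ℝ → E}
    (hφ : ∀ s ≤ 0, φ s = 0) (hi : ∀ a b, IntervalIntegrable φ volume a b)
    (hx : ∀ t, x t = (1 / Real.Gamma α) • abelIntegral α φ t) (hxc : Continuous x)
    {h : ℝ} (hh : 0 < h) (t : ℝ) :
    abelIntegral (1 - α) (fun s => h⁻¹ • (x s - x (s - h))) t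
      = Real.Gamma (1 - α) • movingAverage h φ t := by
  have hα' : 0 < 1 - α := by linarith [hα.2]
  have hΓ : 0 < Real.Gamma α := Real.Gamma_pos_of_pos hα.1
  have hx0 : ∀ s ≤ 0, x s = 0 := fun s hs => by
    rw [hx, abelIntegral_of_nonpos hφ hs, smul_zero]
  have hxint : ∀ t, abelIntegral (1 - α) x t = Real.Gamma (1 - α) • ∫ s in (0 : ℝ)..t, φ s := by
    intro t
    rw [show x = fun t => (1 / Real.Gamma α) • abelIntegral α φ t from funext hx,
      abelIntegral_smul, abelIntegral_abelIntegral_of_causal hα' hα.1 (by ring) hφ hi, smul_smul]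
    congr 1
    field_simp
  have hk := intervalIntegrable_sub_rpow (r := 1 - α - 1) (by linarith) t 0 t
  have hsub : abelIntegral (1 - α) (fun s => x s - x (s - h)) t
      = abelIntegral (1 - α) x t - abelIntegral (1 - α) (fun s => x (s - h)) t := by
    simp only [abelIntegral, smul_sub]
    exact intervalIntegral.integral_sub (hk.smul_continuousOn hxc.continuousOn)
      (hk.smul_continuousOn (hxc.comp (continuous_id.sub continuous_const)).continuousOn)
  rw [abelIntegral_smul, hsub, abelIntegral_comp_sub_const hα' hx0 hxc hh.le, hxint, hxint,
    movingAverage_eq_sub hi, ← smul_sub, smul_comm]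

end Smoothing

theorem norm_le_of_holder {E : Type*} [NormedAddCommGroup E] {T C α : ℝ} (hα : 0 < α) (hC0 : 0 ≤ C)
    {z : ℝ → E} (hz0 : z 0 = 0) (hC : ∀ s t, s ≤ t → ‖z t - z s‖ ≤ C * (t - s) ^ α) {t : ℝ}
    (ht : t ∈ Icc 0 T) : z t ∈ Metric.closedBall (0 : E) (C * T ^ α) := by
  have h := hC 0 t ht.1
  rw [hz0, sub_zero, sub_zero] at h
  rw [mem_closedBall_zero_iff]
  exact h.trans (mul_le_mul_of_nonneg_left (Real.rpow_le_rpow ht.1 ht.2 hα.le) hC0)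

/-! ### Passage to the limit in the chain rule. -/

section ChainRule

variable {E : Type*} [NormedAddCommGroup E] [InnerProductSpace ℝ E] [CompleteSpace E]

theorem bregman_mem_Icc_of_holder {T C L α : ℝ} (hα : 0 < α) (hC0 : 0 ≤ C) (hL : 0 ≤ L)
    {V : E → ℝ} (hV : ConvexOn ℝ univ V) (hd : Differentiable ℝ V)
    (hVL : ∀ u ∈ Metric.closedBall (0 : E) (C * T ^ α),
      ∀ v ∈ Metric.closedBall (0 : E) (C * T ^ α), ‖gradient V u - gradient V v‖ ≤ L * ‖u - v‖)
    {z : ℝ → E} (hz0 : z 0 = 0) (hC : ∀ s t, s ≤ t → ‖z t - z s‖ ≤ C * (t - s) ^ α) {t τ : ℝ}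
    (ht : t ∈ Icc 0 T) (hτ : τ ∈ Icc 0 t) :
    bregman V (z t) (z τ) ∈ Icc 0 (L * C ^ 2 * (t - τ) ^ (2 * α)) := by
  refine ⟨bregman_nonneg hV hd _ _, ?_⟩
  have h1 := bregman_le hd hL hVL (norm_le_of_holder hα hC0 hz0 hC ht)
    (norm_le_of_holder hα hC0 hz0 hC ⟨hτ.1, hτ.2.trans ht.2⟩)
  have h2 := hC τ t hτ.2
  rw [norm_sub_rev] at h2
  have h3 : (t - τ) ^ (2 * α) = ((t - τ) ^ α) ^ 2 := by
    rw [mul_comm, Real.rpow_mul (by linarith [hτ.2])]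
    norm_cast
  calc bregman V (z t) (z τ) ≤ L * ‖z τ - z t‖ ^ 2 := h1
    _ ≤ L * (C * (t - τ) ^ α) ^ 2 := by gcongr
    _ = L * C ^ 2 * (t - τ) ^ (2 * α) := by rw [h3]; ring

/-- The density `ψ` is defined by the limiting formula itself, so the inequality holds at every
point of `(0, T]`; only the representation of `V ∘ x` requires a limit. -/
theorem exists_rlIntegral_comp_eq {α T M : ℝ} (hα : α ∈ Ioo (0 : ℝ) 1) (hT : 0 < T) {V : E → ℝ}
    (hV : ConvexOn ℝ univ V) (hV0 : V 0 = 0) (hd : Differentiable ℝ V)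
    (hVgrad : ∀ r : ℝ, 0 ≤ r → ∃ L : ℝ, 0 < L ∧ ∀ u ∈ Metric.closedBall (0 : E) r,
      ∀ v ∈ Metric.closedBall (0 : E) r, ‖gradient V u - gradient V v‖ ≤ L * ‖u - v‖)
    {φ x : ℝ → E} (hφm : StronglyMeasurable φ) (hφM : ∀ s, ‖φ s‖ ≤ M) (hφ0 : ∀ s ≤ 0, φ s = 0)
    (hx : ∀ t, x t = (1 / Real.Gamma α) • abelIntegral α φ t) :
    ∃ ψ : ℝ → ℝ, MemLp ψ ⊤ (volume.restrict (Icc 0 T)) ∧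
      (∀ t ∈ Icc 0 T, V (x t) = rlIntegral α ψ t) ∧
      ∀ t ∈ Ioc 0 T, ψ t ≤ inner ℝ (gradient V (x t)) (φ t) := by
  have hα0 := hα.1
  have hα' : 0 < 1 - α := by linarith [hα.2]
  have hΓ : 0 < Real.Gamma α := Real.Gamma_pos_of_pos hα0
  have hΓ' : 0 < Real.Gamma (1 - α) := Real.Gamma_pos_of_pos hα'
  have hM : 0 ≤ M := (norm_nonneg _).trans (hφM 0)
  have hgrad : Continuous (gradient V) := continuous_gradient_of_lipschitz_on_balls hVgrad
  have hφi : ∀ a b, IntervalIntegrable φ volume a b := fun a b =>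
    (intervalIntegrable_const (c := M)).mono_fun' hφm.aestronglyMeasurable
      (Eventually.of_forall hφM)
  set C : ℝ := 1 / Real.Gamma α * (2 * M / α) with hCdef
  have hC0 : 0 ≤ C := by positivity
  have hxC : ∀ s t, s ≤ t → ‖x t - x s‖ ≤ C * (t - s) ^ α := by
    intro s t hst
    rw [hx, hx, ← smul_sub, norm_smul, Real.norm_of_nonneg (by positivity), hCdef, mul_assoc]
    exact mul_le_mul_of_nonneg_left (abelIntegral_sub_le_of_causal hα hφ0 hφm hφM hst)
      (by positivity)
  have hxc : Continuous x := by
    rw [← continuousOn_univ]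
    exact continuousOn_of_holder hα0 fun s _ t _ hst => hxC s t hst
  have hxz : ∀ s ≤ 0, x s = 0 := fun s hs => by
    rw [hx, abelIntegral_of_nonpos hφ0 hs, smul_zero]
  -- On `[0, T]` the path `x` and all its averages stay in this ball, so a single `L` serves every
  -- `k`.
  obtain ⟨L, hL, hVL⟩ := hVgrad (C * T ^ α) (by positivity)
  let h : ℕ → ℝ := fun k => 1 / ((k : ℝ) + 1)
  have hh : ∀ k, 0 < h k := fun k => by positivity
  have hlim0 : Tendsto h atTop (𝓝[>] 0) :=
    tendsto_nhdsWithin_iff.2 ⟨tendsto_one_div_add_atTop_nhds_zero_nat, Eventually.of_forall hh⟩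
  let z : ℕ → ℝ → E := fun k => movingAverage (h k) x
  let z' : ℕ → ℝ → E := fun k s => (h k)⁻¹ • (x s - x (s - h k))
  have hz : ∀ k s, HasDerivAt (z k) (z' k s) s := fun k s => hasDerivAt_movingAverage hxc (h k) s
  have hzc : ∀ k, Continuous (z k) := fun k =>
    continuous_iff_continuousAt.2 fun s => (hz k s).continuousAt
  have hz'c : ∀ k, Continuous (z' k) := fun k =>
    (hxc.sub (hxc.comp (continuous_id.sub continuous_const))).const_smul _
  have hz0 : ∀ k, z k 0 = 0 := fun k => movingAverage_zero hxz (hh k)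
  have hzC : ∀ k s t, s ≤ t → ‖z k t - z k s‖ ≤ C * (t - s) ^ α := fun k s t hst =>
    norm_movingAverage_sub_le hxc (hh k) hxC hst
  have hzlim : ∀ t, Tendsto (fun k => z k t) atTop (𝓝 (x t)) := fun t =>
    (tendsto_movingAverage (fun a b => hxc.intervalIntegrable a b)
      (hxc.integral_hasStrictDerivAt 0 t).hasDerivAt).comp hlim0
  have hzB : ∀ k, ∀ t ∈ Icc 0 T, ∀ τ ∈ Icc 0 t,
      bregman V (z k t) (z k τ) ∈ Icc 0 (L * C ^ 2 * (t - τ) ^ (2 * α)) := fun k t ht τ hτ =>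
    bregman_mem_Icc_of_holder hα0 hC0 hL.le hV hd hVL (hz0 k) (hzC k) ht hτ
  have hgi : ∀ k, Continuous fun s => (inner ℝ (gradient V (z k s)) (z' k s) : ℝ) := fun k =>
    (hgrad.comp (hzc k)).inner (hz'c k)
  let Ψ : ℕ → ℝ → ℝ := fun k =>
    abelIntegral (1 - α) (fun s => inner ℝ (gradient V (z k s)) (z' k s))
  let Ψ₀ : ℝ → ℝ := fun t =>
    inner ℝ (gradient V (x t)) (Real.Gamma (1 - α) • φ t) - bregmanCorrection α V x t
  have hΨ : ∀ k, ∀ t ∈ Ioc 0 T, Ψ k t =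
      inner ℝ (gradient V (z k t)) (Real.Gamma (1 - α) • movingAverage (h k) φ t)
        - bregmanCorrection α V (z k) t := by
    intro k t ht
    rw [← abelIntegral_deriv_movingAverage hα hφ0 hφi hx hxc (hh k) t]
    exact abelIntegral_inner_gradient hα ht.1 hd hgrad (hz k) (hz'c k) (hz0 k)
      (hzB k t ⟨ht.1.le, ht.2⟩)
  have hVΨ : ∀ k, ∀ t ∈ Icc 0 T,
      abelIntegral α (Ψ k) t = Real.Gamma α * Real.Gamma (1 - α) * V (z k t) := by
    intro k t ht
    have hi := (hgi k).intervalIntegrable (μ := volume) 0 t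
    rw [abelIntegral_abelIntegral hα0 hα' (by ring) ht.1 hi, smul_eq_mul,
      intervalIntegral.integral_eq_sub_of_hasDerivAt
        (fun s _ => hasDerivAt_comp_of_gradient hd (hz k s)) hi, hz0 k, hV0, sub_zero]
  -- Only the averages of `φ` restrict the convergence to almost every `t`; `z k` and its correction
  -- term converge at each `t`.
  have hΨlim : ∀ᵐ t : ℝ, t ∈ Ioc 0 T → Tendsto (fun k => Ψ k t) atTop (𝓝 (Ψ₀ t)) := by
    have hloc : LocallyIntegrable φ volume := fun s =>
      ⟨Icc (s - 1) (s + 1), Icc_mem_nhds (by linarith) (by linarith), by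
        rw [← intervalIntegrable_iff_integrableOn_Icc_of_le (by linarith)]; exact hφi _ _⟩
    filter_upwards [_root_.LocallyIntegrable.ae_hasDerivAt_integral hloc] with t hdt ht
    have h1 : Tendsto (fun k => movingAverage (h k) φ t) atTop (𝓝 (φ t)) :=
      (tendsto_movingAverage hφi (hdt 0)).comp hlim0
    have h2 : Tendsto (fun k => bregmanCorrection α V (z k) t) atTop
        (𝓝 (bregmanCorrection α V x t)) :=
      tendsto_bregmanCorrection hα0 ht.1 hd hgrad (Eventually.of_forall hzc)
        (fun τ _ => hzlim τ) (Eventually.of_forall fun k => hzB k t ⟨ht.1.le, ht.2⟩)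
    refine Tendsto.congr (fun k => (hΨ k t ht).symm) (Tendsto.sub ?_ h2)
    exact ((hgrad.tendsto _).comp (hzlim t)).inner (h1.const_smul _)
  -- Bound on `‖∇V‖` over the ball times the bound on `Γ(1 - α) D^α z_k`, plus the bound on the
  -- correction with `B = L * C ^ 2`.
  set K : ℝ := (‖gradient V 0‖ + L * (C * T ^ α)) * (Real.Gamma (1 - α) * M)
    + 2 * (L * C ^ 2) * T ^ α with hK
  have hΨK : ∀ k, ∀ t ∈ Ioc 0 T, ‖Ψ k t‖ ≤ K := by
    intro k t ht
    have htT : t ∈ Icc 0 T := ⟨ht.1.le, ht.2⟩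
    have hzr := norm_le_of_holder hα0 hC0 (hz0 k) (hzC k) htT
    have h1 : ‖gradient V (z k t)‖ ≤ ‖gradient V 0‖ + L * (C * T ^ α) := by
      have h2 := hVL _ hzr 0 (Metric.mem_closedBall_self (by positivity))
      rw [sub_zero] at h2
      have h3 := norm_le_insert' (gradient V (z k t)) (gradient V 0)
      have h4 := mul_le_mul_of_nonneg_left (mem_closedBall_zero_iff.1 hzr) hL.le
      linarith
    have h5 : ‖Real.Gamma (1 - α) • movingAverage (h k) φ t‖ ≤ Real.Gamma (1 - α) * M := by
      rw [norm_smul, Real.norm_of_nonneg hΓ'.le]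
      exact mul_le_mul_of_nonneg_left (norm_movingAverage_le (hh k) hφM) hΓ'.le
    have h6 := bregmanCorrection_mem_Icc hα0 ht.1 hd hgrad (hzc k) (hz0 k) (hzB k t htT)
    have h7 : 2 * (L * C ^ 2) * t ^ α ≤ 2 * (L * C ^ 2) * T ^ α :=
      mul_le_mul_of_nonneg_left (Real.rpow_le_rpow ht.1.le ht.2 hα0.le) (by positivity)
    rw [hΨ k t ht, hK]
    refine (norm_sub_le _ _).trans (add_le_add ?_ ?_)
    · exact (norm_inner_le_norm _ _).trans
        (mul_le_mul h1 h5 (norm_nonneg _) (by positivity))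
    · rw [Real.norm_of_nonneg h6.1]
      exact h6.2.trans h7
  have hΨm : ∀ k, AEStronglyMeasurable (Ψ k) (volume.restrict (Ioc 0 T)) := fun k =>
    ((continuousOn_abelIntegral ⟨hα', by linarith⟩ (hgi k).continuousOn.memLp_top_Icc).mono
      Ioc_subset_Icc_self).aestronglyMeasurable measurableSet_Ioc
  have hΨ₀ : MemLp Ψ₀ ⊤ (volume.restrict (Icc 0 T)) := by
    rw [← Measure.restrict_congr_set Ioc_ae_eq_Icc]
    refine MemLp.of_bound (aestronglyMeasurable_of_tendsto_ae atTop hΨm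
      ((ae_restrict_iff' measurableSet_Ioc).2 hΨlim)) K ?_
    rw [ae_restrict_iff' measurableSet_Ioc]
    filter_upwards [hΨlim] with t hlt ht
    exact le_of_tendsto (hlt ht).norm (Eventually.of_forall fun k => hΨK k t ht)
  -- Both sides of `hVΨ` are passed to the limit: the left by dominated convergence with the
  -- constant `K`, the right by continuity of `V`.
  have hVΨ₀ : ∀ t ∈ Icc 0 T, abelIntegral α Ψ₀ t = Real.Gamma α * Real.Gamma (1 - α) * V (x t) := by
    intro t ht
    have hsub : ∀ s, s ∈ uIoc 0 t → s ∈ Ioc 0 T := fun s hs => by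
      rw [uIoc_of_le ht.1] at hs
      exact ⟨hs.1, hs.2.trans ht.2⟩
    have hker : ∀ s, s ∈ uIoc 0 t → 0 ≤ (t - s) ^ (α - 1) := fun s hs => by
      rw [uIoc_of_le ht.1] at hs
      exact Real.rpow_nonneg (by linarith [hs.2]) _
    have hleft : Tendsto (fun k => abelIntegral α (Ψ k) t) atTop (𝓝 (abelIntegral α Ψ₀ t)) := by
      refine intervalIntegral.tendsto_integral_filter_of_dominated_convergence
        (fun s => (t - s) ^ (α - 1) * K) (Eventually.of_forall fun k => ?_)
        (Eventually.of_forall fun k => Eventually.of_forall fun s hs => ?_)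
        ((intervalIntegrable_sub_rpow (by linarith) t 0 t).mul_const K) ?_
      · have hmk : Measurable fun s : ℝ => (t - s) ^ (α - 1) := by fun_prop
        exact hmk.aestronglyMeasurable.smul
          ((hΨm k).mono_measure (Measure.restrict_mono hsub le_rfl))
      · rw [norm_smul, Real.norm_of_nonneg (hker s hs)]
        exact mul_le_mul_of_nonneg_left (hΨK k s (hsub s hs)) (hker s hs)
      · filter_upwards [hΨlim] with s hls hs
        exact (hls (hsub s hs)).const_smul _
    refine tendsto_nhds_unique hleft ?_
    refine Tendsto.congr (fun k => (hVΨ k t ht).symm) (Tendsto.const_mul _ ?_)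
    exact (hd.continuous.tendsto _).comp (hzlim t)
  refine ⟨(1 / Real.Gamma (1 - α)) • Ψ₀, hΨ₀.const_smul _, fun t ht => ?_,
    fun t ht => ?_⟩
  · have hs : abelIntegral α ((1 / Real.Gamma (1 - α)) • Ψ₀) t
        = (1 / Real.Gamma (1 - α)) • abelIntegral α Ψ₀ t := abelIntegral_smul α _ Ψ₀ t
    rw [rlIntegral_eq_abelIntegral _ ht.1, hs, hVΨ₀ t ht, smul_eq_mul, smul_eq_mul]
    field_simp
  · have h1 := bregmanCorrection_mem_Icc hα0 ht.1 hd hgrad hxc (hxz 0 le_rfl) fun τ hτ =>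
      bregman_mem_Icc_of_holder hα0 hC0 hL.le hV hd hVL (hxz 0 le_rfl) hxC ⟨ht.1.le, ht.2⟩ hτ
    have h2 : (1 / Real.Gamma (1 - α)) • Ψ₀ t = inner ℝ (gradient V (x t)) (φ t)
        - 1 / Real.Gamma (1 - α) * bregmanCorrection α V x t := by
      simp only [Ψ₀, inner_smul_right, smul_eq_mul]
      field_simp
    have h3 : 0 ≤ 1 / Real.Gamma (1 - α) * bregmanCorrection α V x t :=
      mul_nonneg (by positivity) h1.1
    rw [Pi.smul_apply, h2]
    linarith

end ChainRule

/-! ### Choice of representative and conclusion. -/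

theorem exists_bounded_causal_representative {E : Type*} [NormedAddCommGroup E] {T : ℝ}
    {φ : ℝ → E} (hφ : MemLp φ ⊤ (volume.restrict (Icc 0 T))) :
    ∃ (φ' : ℝ → E) (M : ℝ), StronglyMeasurable φ' ∧ (∀ s, ‖φ' s‖ ≤ M) ∧ (∀ s ≤ 0, φ' s = 0) ∧
      ∀ᵐ s, s ∈ Icc 0 T → φ s = φ' s := by
  obtain ⟨M, hM, hφM⟩ := exists_ae_norm_le_of_memLp_top hφ
  have hmk := (ae_restrict_iff' measurableSet_Icc).1 hφ.1.ae_eq_mk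
  have hsm := hφ.1.stronglyMeasurable_mk
  refine ⟨(Ioi 0 ∩ {s | ‖hφ.1.mk φ s‖ ≤ M}).indicator (hφ.1.mk φ), M, ?_, fun s => ?_,
    fun s hs => ?_, ?_⟩
  · exact hsm.indicator (measurableSet_Ioi.inter (measurableSet_le hsm.norm.measurable measurable_const))
  · by_cases h : s ∈ Ioi 0 ∩ {s | ‖hφ.1.mk φ s‖ ≤ M}
    · rw [indicator_of_mem h]; exact h.2
    · rw [indicator_of_notMem h, norm_zero]; exact hM
  · exact indicator_of_notMem (fun h => not_lt.2 hs h.1) _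
  · have hne : ∀ᵐ s : ℝ, s ≠ 0 := by simp [ae_iff, measure_singleton]
    filter_upwards [hφM, hmk, hne] with s h1 h2 h3 hs
    have h4 : s ∈ Ioi 0 ∩ {s | ‖hφ.1.mk φ s‖ ≤ M} :=
      ⟨lt_of_le_of_ne hs.1 h3.symm, show ‖hφ.1.mk φ s‖ ≤ M by rw [← h2 hs]; exact h1 hs⟩
    rw [indicator_of_mem h4]
    exact h2 hs

theorem mainTheorem2 (n : ℕ) (α T : ℝ) (hα : α ∈ Ioo (0 : ℝ) 1) (hT : 0 < T)
    (V : EuclideanSpace ℝ (Fin n) → ℝ)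
    (hVconvex : ConvexOn ℝ univ V) (hV0 : V 0 = 0)
    (hVdiff : Differentiable ℝ V)
    (hVgrad : ∀ r : ℝ, 0 ≤ r → ∃ L : ℝ, 0 < L ∧
      ∀ u ∈ Metric.closedBall (0 : EuclideanSpace ℝ (Fin n)) r,
        ∀ v ∈ Metric.closedBall (0 : EuclideanSpace ℝ (Fin n)) r,
          ‖gradient V u - gradient V v‖ ≤ L * ‖u - v‖)
    (x : ℝ → EuclideanSpace ℝ (Fin n)) (hx : MemRLIntegralLinfty T α x) :
    MemRLIntegralLinfty T α (fun t => V (x t)) ∧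
      ∀ᵐ t ∂(volume.restrict (Icc 0 T)),
        RLDifferentiableAt T α x t ∧
        RLDifferentiableAt T α (fun s => V (x s)) t ∧
        rlDeriv T α (fun s => V (x s)) t ≤ inner ℝ (gradient V (x t)) (rlDeriv T α x t) := by
  obtain ⟨φ, hφ, hxφ⟩ := hx
  obtain ⟨φ', M, hφm, hφM, hφ0, hφφ'⟩ := exists_bounded_causal_representative hφ
  have hxx : ∀ t ∈ Icc 0 T, x t = (1 / Real.Gamma α) • abelIntegral α φ' t := by
    intro t ht
    rw [hxφ t ht, rlIntegral_eq_abelIntegral φ ht.1, abelIntegral_congr_ae ht.1]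
    filter_upwards [hφφ'] with s hs hst
    exact hs ⟨hst.1, hst.2.trans ht.2⟩
  -- The chain rule is applied to the causal extension of `x` to the whole line, which agrees with
  -- `x` on `[0, T]`.
  obtain ⟨ψ, hψ, hVψ, hle⟩ := exists_rlIntegral_comp_eq (T := T) hα hT hVconvex hV0 hVdiff hVgrad
    hφm hφM hφ0 (x := fun t => (1 / Real.Gamma α) • abelIntegral α φ' t) fun _ => rfl
  have hyψ : ∀ t ∈ Icc 0 T, V (x t) = rlIntegral α ψ t := fun t ht => by
    rw [hxx t ht]; exact hVψ t ht
  refine ⟨⟨ψ, hψ, hyψ⟩, ?_⟩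
  have hne : ∀ᵐ t ∂(volume.restrict (Icc 0 T)), t ≠ 0 :=
    ae_restrict_of_ae (by simp [ae_iff, measure_singleton])
  filter_upwards [ae_rlDeriv_eq hα hT hφ hxφ, ae_rlDeriv_eq hα hT hψ hyψ, hne,
    (ae_restrict_iff' measurableSet_Icc).2 hφφ', ae_restrict_mem measurableSet_Icc]
    with t h1 h2 ht0 h3 ht
  refine ⟨h1.1, h2.1, ?_⟩
  rw [h1.2, h2.2, h3, hxx t ht]
  exact hle t ⟨lt_of_le_of_ne ht.1 ht0.symm, ht.2⟩
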